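/- Let $\mathcal P=(\mathcal P,d,\mu)$ be a metric space equipped with a complete measure $\mu$, defined on a $\sigma$-algebra containing the Borel sets, such that $0<\mu(B)<\infty$ for every ball $B$. Let $X$ be a quasi-Banach function lattice on $\mathcal P$, i.e. $X=\{u:\|u\|_X<\infty\}$, where $\|\cdot\|_X$ assigns a value in $[0,\infty]$ to every (everywhere defined) measurable function $\mathcal P\to[-\infty,\infty]$ and, for some constant $c\ge 1$ and all measurable $u,v,u_n$ and $a\in\mathbf R$: * $\|u\|_X=0$ if and only if $u=0$ a.e.; $\|au\|_X=|a|\,\|u\|_X$; $\|u+v\|_X\le c(\|u\|_X+\|v\|_X)$; * if $|u|\le|v|$ a.e., then $\|u\|_X\le\|v\|_X$; * if $u_n\ge0$ a.e. for $n=1,2,\dots$, then $\bigl\|\sum_{n=1}^\infty u_n\bigr\|_X\le\sum_{n=1}^\infty c^n\|u_n\|_X$. Assume also that the quasinorm is continuous: $\|u_n-u\|_X\to0$ implies $\|u_n\|_X\to\|u\|_X$. A Borel function $g:\mathcal P\to[0,\infty]$ is an upper gradient of $u:\mathcal P\to[-\infty,\infty]$ if $|u(\gamma(0))-u(\gamma(l_\gamma))|\le\int_\gamma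 g\,ds$ for every nonconstant rectifiable curve $\gamma:[0,l_\gamma]\to\mathcal P$ parametrized by arc length, with the convention $|(\pm\infty)-(\pm\infty)|=\infty$. For $u \in X$ let $\|u\|_{N^1X}=\|u\|_X+\inf_g\|g\|_X$, the infimum being over all upper gradients $g$ of $u$, and let $N^1X=\{u\in X:\|u\|_{N^1X}<\infty\}$. The capacity of $E\subset\mathcal P$ is $$C_X(E)=\inf\{\|u\|_{N^1X}:u\in N^1X,\ u\ge1\text{ on }E\}\qquad(\inf\emptyset=\infty).$$ $C_X$ is an outer capacity if $\inf\{C_X(G):G\supset E,\ G\text{ open}\}\le C_X(E)$ for every $E\subset\mathcal P$. A function $u:\mathcal P\to[-\infty,\infty]$ is weakly quasicontinuous if for every $\varepsilon>0$ there is a set $E\subset\mathcal P$ with $C_X(E)<\varepsilon$ such that $u|_{\mathcal P\setminus E}$ is real-valued and continuous; it is quasicontinuous if for every $\varepsilon>0$ such a set $E$ can be chosen open. **Theorem.** Assume that $X$ has the Vitali–Carathéodory property, i.e. $$\|u\|_X=\inf\{\|v\|_X: v\ge|u|\text{ and }v\text{ is lower semicontinuous on }\mathcal P\}$$ for every measurable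 $u:\mathcal P\to[-\infty,\infty]$. (a) If $\mathcal P$ is proper (i.e. all closed balls are compact), then $C_X$ is an outer capacity. (b) If $\mathcal P$ is locally compact, then every weakly quasicontinuous function $u:\mathcal P\to[-\infty,\infty]$ is quasicontinuous. -/

import Mathlib

open scoped ENNReal NNReal Topology

/-- `μ` is positive and finite on every (open) ball. -/
def PositiveFiniteOnBalls {P : Type*} [MetricSpace P] [MeasurableSpace P]
    (μ : MeasureTheory.Measure P) : Prop :=
  ∀ (x : P) (r : ℝ), 0 < r → 0 < μ (Metric.ball x r) ∧ μ (Metric.ball x r) < ∞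

/-- A quasi-Banach function lattice over `(P, μ)`, given by its quasinorm `‖·‖_X`, a functional
on the everywhere defined measurable functions `u : P → [-∞, ∞]` with values in `[0, ∞]`;
the space itself is `X = {u : ‖u‖_X < ∞}`, see `QuasiBanachFunctionLattice.carrier`.
(The value of `qnorm` at a nonmeasurable function is irrelevant and never used. By `eq_zero_iff`,
`smul` and `lattice`, a function of finite quasinorm is finite a.e., so in `add_le` the convention
for `∞ - ∞` plays no role.) -/
structure QuasiBanachFunctionLattice {P : Type*} [MeasurableSpace P]
    (μ : MeasureTheory.Measure P) where
  /-- the quasinorm -/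
  qnorm : (P → EReal) → ℝ≥0∞
  /-- the modulus of concavity -/
  concavity : ℝ≥0
  one_le_concavity : 1 ≤ concavity
  eq_zero_iff : ∀ u : P → EReal, Measurable u → (qnorm u = 0 ↔ ∀ᵐ x ∂μ, u x = 0)
  smul : ∀ (a : ℝ) (u : P → EReal), Measurable u →
    qnorm (fun x => (a : EReal) * u x) = ENNReal.ofReal |a| * qnorm u
  add_le : ∀ u v : P → EReal, Measurable u → Measurable v →
    qnorm (fun x => u x + v x) ≤ concavity * (qnorm u + qnorm v)
  /-- the lattice property -/
  lattice : ∀ u v : P → EReal, Measurable u → Measurable v →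
    (∀ᵐ x ∂μ, (u x).abs ≤ (v x).abs) → qnorm u ≤ qnorm v
  /-- the Riesz--Fischer property; the sequence `u 0, u 1, …` is `u₁, u₂, …` in the usual
  numbering `‖∑_{n ≥ 1} u_n‖ ≤ ∑_{n ≥ 1} c ^ n ‖u_n‖` -/
  riesz_fischer : ∀ u : ℕ → P → ℝ≥0∞, (∀ n, Measurable (u n)) →
    qnorm (fun x => ((∑' n, u n x : ℝ≥0∞) : EReal)) ≤
      ∑' n, (concavity : ℝ≥0∞) ^ (n + 1) * qnorm (fun x => (u n x : EReal))

/-- `g` is an upper gradient of `u`: `g` is a Borel function and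
`|u(γ(0)) - u(γ(l))| ≤ ∫_γ g ds` for every nonconstant rectifiable curve `γ : [0, l] → P`
parametrized by arc length. (In `EReal`, both `⊤ - ⊤` and `⊥ - ⊥` equal `⊥`, of absolute value
`∞`; thus the convention `|(±∞) - (±∞)| = ∞` is in force. Unit speed curves are 1-Lipschitz, hence
continuous.) -/
def IsUpperGradient {P : Type*} [MetricSpace P] (g : P → ℝ≥0∞) (u : P → EReal) : Prop :=
  @Measurable P ℝ≥0∞ (borel P) inferInstance g ∧
    ∀ (l : ℝ) (γ : ℝ → P), 0 < l → HasUnitSpeedOn γ (Set.Icc 0 l) →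
      (u (γ 0) - u (γ l)).abs ≤ ∫⁻ t in Set.Icc 0 l, g (γ t)

namespace QuasiBanachFunctionLattice

section Lattice

variable {P : Type*} [MeasurableSpace P] {μ : MeasureTheory.Measure P}

/-- The set of functions `X`. -/
def carrier (X : QuasiBanachFunctionLattice μ) : Set (P → EReal) :=
  {u | Measurable u ∧ X.qnorm u < ∞}

/-- The quasinorm is continuous: `‖u_n - u‖_X → 0` implies `‖u_n‖_X → ‖u‖_X`. -/
def ContinuousQuasinorm (X : QuasiBanachFunctionLattice μ) : Prop :=
  ∀ (u : ℕ → P → EReal) (v : P → EReal), (∀ n, Measurable (u n)) → Measurable v →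
    Filter.Tendsto (fun n => X.qnorm (fun x => u n x - v x)) Filter.atTop (𝓝 0) →
    Filter.Tendsto (fun n => X.qnorm (u n)) Filter.atTop (𝓝 (X.qnorm v))

end Lattice

variable {P : Type*} [MetricSpace P] [MeasurableSpace P] {μ : MeasureTheory.Measure P}

/-- `‖u‖_{N¹X} = ‖u‖_X + inf_g ‖g‖_X`, the infimum being over all upper gradients `g` of `u`. -/
noncomputable def newtonianNorm (X : QuasiBanachFunctionLattice μ) (u : P → EReal) : ℝ≥0∞ :=
  X.qnorm u + ⨅ (g : P → ℝ≥0∞) (_ : IsUpperGradient g u), X.qnorm (fun x => (g x : EReal))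

/-- The Newtonian space `N¹X`. -/
def newtonianSpace (X : QuasiBanachFunctionLattice μ) : Set (P → EReal) :=
  {u | u ∈ X.carrier ∧ X.newtonianNorm u < ∞}

/-- The Sobolev `X`-capacity `C_X(E) = inf {‖u‖_{N¹X} : u ∈ N¹X, u ≥ 1 on E}`, with
`inf ∅ = ∞`. -/
noncomputable def capacity (X : QuasiBanachFunctionLattice μ) (E : Set P) : ℝ≥0∞ :=
  ⨅ (u : P → EReal) (_ : u ∈ X.newtonianSpace) (_ : ∀ x ∈ E, 1 ≤ u x), X.newtonianNorm u

/-- `C_X` is a `c`-quasiouter capacity. -/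
def IsQuasiouterCapacityWith (X : QuasiBanachFunctionLattice μ) (c : ℝ≥0) : Prop :=
  ∀ E : Set P, (⨅ (G : Set P) (_ : IsOpen G) (_ : E ⊆ G), X.capacity G) ≤ c * X.capacity E

/-- `C_X` is an outer capacity. -/
def IsOuterCapacity (X : QuasiBanachFunctionLattice μ) : Prop :=
  X.IsQuasiouterCapacityWith 1

/-- The restriction of `u` to `P \ E` is a continuous real-valued function. -/
def ContinuousRealOff {P : Type*} [MetricSpace P] (u : P → EReal) (E : Set P) : Prop :=
  ContinuousOn u Eᶜ ∧ ∀ x ∈ Eᶜ, u x ≠ ⊤ ∧ u x ≠ ⊥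

/-- Weak quasicontinuity with respect to `C_X`. -/
def WeaklyQuasicontinuous (X : QuasiBanachFunctionLattice μ) (u : P → EReal) : Prop :=
  ∀ ε : ℝ≥0, 0 < ε → ∃ E : Set P, X.capacity E < ε ∧ ContinuousRealOff u E

/-- Quasicontinuity with respect to `C_X`. -/
def Quasicontinuous (X : QuasiBanachFunctionLattice μ) (u : P → EReal) : Prop :=
  ∀ ε : ℝ≥0, 0 < ε → ∃ G : Set P, IsOpen G ∧ X.capacity G < ε ∧ ContinuousRealOff u G

/-- The Vitali--Carathéodory property: `‖u‖_X` is the infimum of `‖v‖_X` over all lower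
semicontinuous `v ≥ |u|`, for every measurable `u : P → [-∞, ∞]`. -/
def VitaliCaratheodory (X : QuasiBanachFunctionLattice μ) : Prop :=
  ∀ u : P → EReal, Measurable u →
    X.qnorm u = ⨅ (v : P → EReal) (_ : ∀ x, ((u x).abs : EReal) ≤ v x)
      (_ : LowerSemicontinuous v), X.qnorm v

end QuasiBanachFunctionLattice

/-! Let `u ≥ 1` on `E` be nearly optimal for the capacity. By Vitali–Carathéodory it has, at almost
no cost, a lower semicontinuous upper gradient `g` and a lower semicontinuous majorant `v ≥ |u|`.
The function `u` itself is then discarded: for an open `Ω` and `r > 0`, let `U(x)` be the infimum,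
over curves starting at `x`, of `v` at the end point plus the integral of `g + v / r`, both cut off
outside `Ω` (`curveInf`). Constant curves give `U ≤ v`, and concatenation of curves shows that `U`
is controlled by `g + v / r`. The upper gradient inequality for `u` gives `U ≥ 1` at points of `E`
whose `r`-ball lies in `Ω` (`one_le_curveInf`).

The crux is that `U` is lower semicontinuous when closed bounded parts of `closure Ω` are compact
(`lowerSemicontinuous_curveInf`). This is Arzelà–Ascoli plus Fatou. Near-optimal curves may have
lengths tending to infinity; the term `v / r` handles this case, since a finite integral of `v` over
an infinite curve forces `v` to be small somewhere along it, and the curve can be stopped there.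

For (a), take `Ω = P`. Superlevel sets of `U` are open, and as `r → ∞` continuity of the quasinorm
removes the cost of `v / r`. For (b), take balls with compact closure. The cost is now a constant
depending on the ball, but it is harmless: the space is covered by countably many balls, the
exceptional sets can be taken as small as needed in each, and the Riesz–Fischer property sums the
resulting functions. -/

open MeasureTheory Set Filter Metric

/-! ### Lipschitz curves and arc length. -/

section Curves

variable {P : Type*} [MetricSpace P]

/-- A curve that is `1`-Lipschitz on `[0, l]` extends to a `1`-Lipschitz curve on `ℝ`, constant
outside of `[0, l]`. -/
theorem LipschitzOnWith.exists_lipschitzWith_eqOn_Icc {γ : ℝ → P} {l : ℝ} (hl : 0 ≤ l)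
    (hγ : LipschitzOnWith 1 γ (Icc 0 l)) :
    ∃ γ' : ℝ → P, LipschitzWith 1 γ' ∧ EqOn γ' γ (Icc 0 l) ∧ ∀ t, γ' t ∈ γ '' Icc 0 l := by
  refine ⟨fun t => γ (projIcc 0 l hl t), ?_, fun t ht => ?_, fun t => ⟨_, (projIcc 0 l hl t).2, rfl⟩⟩
  · have := hγ.to_restrict.comp (LipschitzWith.projIcc hl)
    simpa [Function.comp_def] using this
  · simp [projIcc_of_mem hl ht]

theorem LipschitzWith.reverse {γ : ℝ → P} (hγ : LipschitzWith 1 γ) (l : ℝ) :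
    LipschitzWith 1 fun t => γ (l - t) := by
  refine LipschitzWith.of_dist_le_mul fun s t => (hγ.dist_le_mul _ _).trans ?_
  simp only [Real.dist_eq]
  rw [show l - s - (l - t) = -(s - t) by ring, abs_neg]

/-- Concatenation of `1`-Lipschitz curves. -/
theorem LipschitzWith.concat {γ₁ γ₂ : ℝ → P} (h₁ : LipschitzWith 1 γ₁) (h₂ : LipschitzWith 1 γ₂)
    {l : ℝ} (h : γ₂ 0 = γ₁ l) : LipschitzWith 1 fun t => if t ≤ l then γ₁ t else γ₂ (t - l) := by
  have key : ∀ s t, s ≤ t → dist (if s ≤ l then γ₁ s else γ₂ (s - l))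
      (if t ≤ l then γ₁ t else γ₂ (t - l)) ≤ t - s := by
    intro s t hst
    have d₁ := fun a b => h₁.dist_le_mul a b
    have d₂ := fun a b => h₂.dist_le_mul a b
    simp only [NNReal.coe_one, one_mul, Real.dist_eq] at d₁ d₂
    split_ifs with hs ht ht
    · refine (d₁ s t).trans ?_
      rw [abs_sub_comm, abs_of_nonneg (by linarith)]
    · refine (dist_triangle _ (γ₁ l) _).trans ?_
      have e₁ := d₁ s l
      have e₂ := d₂ 0 (t - l)
      rw [h] at e₂
      rw [abs_sub_comm, abs_of_nonneg (by linarith)] at e₁ e₂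
      linarith
    · linarith
    · refine (d₂ _ _).trans ?_
      rw [abs_sub_comm, abs_of_nonneg (by linarith)]
      linarith
  refine LipschitzWith.of_dist_le_mul fun s t => ?_
  simp only [NNReal.coe_one, one_mul, Real.dist_eq]
  rcases le_total s t with hst | hst
  · rw [abs_sub_comm, abs_of_nonneg (by linarith)]
    exact key s t hst
  · rw [abs_of_nonneg (by linarith), dist_comm]
    exact key t s hst

theorem HasUnitSpeedOn.lipschitzOnWith {γ : ℝ → P} {l : ℝ} (h : HasUnitSpeedOn γ (Icc 0 l)) :
    LipschitzOnWith 1 γ (Icc 0 l) := by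
  have key : ∀ s ∈ Icc 0 l, ∀ t ∈ Icc 0 l, s ≤ t → edist (γ s) (γ t) ≤ edist s t := by
    intro s hs t ht hst
    have h1 := h hs ht
    rw [NNReal.coe_one, one_mul] at h1
    rw [edist_comm s t, edist_dist t s, Real.dist_eq, abs_of_nonneg (by linarith), ← h1]
    exact eVariationOn.edist_le γ ⟨hs, le_rfl, hst⟩ ⟨ht, hst, le_rfl⟩
  intro s hs t ht
  rw [ENNReal.coe_one, one_mul]
  rcases le_total s t with hst | hst
  · exact key s hs t ht hst
  · rw [edist_comm, edist_comm s]
    exact key t ht s hs hst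

/-- The variation over `[b, c]` is at most `c - b`. This makes the arc length function an admissible
parameter change in `setLIntegral_image_le_of_lipschitzWith`. -/
theorem LipschitzWith.lipschitzOnWith_variationOnFromTo {γ : ℝ → P} (hγ : LipschitzWith 1 γ)
    {s : Set ℝ} {a : ℝ} (ha : a ∈ s) : LipschitzOnWith 1 (variationOnFromTo γ s a) s := by
  have hloc : LocallyBoundedVariationOn γ s := (hγ.lipschitzOnWith (s := s)).locallyBoundedVariationOn
  have key : ∀ b ∈ s, ∀ c ∈ s, b ≤ c →
      |variationOnFromTo γ s a c - variationOnFromTo γ s a b| ≤ c - b := by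
    intro b hb c hc hbc
    have e := variationOnFromTo.add hloc ha hb hc
    rw [← e, add_sub_cancel_left, abs_of_nonneg (variationOnFromTo.nonneg_of_le _ _ hbc),
      variationOnFromTo.eq_of_le _ _ hbc]
    refine ENNReal.toReal_le_of_le_ofReal (by linarith) ?_
    rw [← eVariationOn_id_Icc]
    refine (eVariationOn.mono _ inter_subset_right).trans ?_
    have := (hγ.lipschitzOnWith (s := univ)).comp_eVariationOn_le (f := γ) (g := id)
      (s := Icc b c) (mapsTo_univ _ _)
    simpa using this
  refine LipschitzOnWith.of_dist_le_mul fun b hb c hc => ?_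
  simp only [NNReal.coe_one, one_mul, Real.dist_eq]
  rcases le_total b c with h | h
  · rw [abs_sub_comm, abs_sub_comm b, abs_of_nonneg (sub_nonneg.2 h)]
    exact key b hb c hc h
  · rw [abs_of_nonneg (sub_nonneg.2 h)]
    exact key c hc b hb h

/-- A `1`-Lipschitz parameter change does not decrease integrals over its image. -/
theorem setLIntegral_image_le_of_lipschitzWith {s : ℝ → ℝ} (hs : LipschitzWith 1 s) (A : Set ℝ)
    {f : ℝ → ℝ≥0∞} (hf : Measurable f) :
    ∫⁻ t in s '' A, f t ≤ ∫⁻ t in A, f (s t) := by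
  rw [← lintegral_map hf hs.continuous.measurable]
  -- It suffices to compare measures: Lebesgue measure on the image is dominated by the pushforward,
  -- because a 1-Lipschitz map does not increase one-dimensional Hausdorff measure.
  refine lintegral_mono' (Measure.le_intro fun B hB _ => ?_) le_rfl
  rw [Measure.restrict_apply hB, Measure.map_apply hs.continuous.measurable hB,
    Measure.restrict_apply (hs.continuous.measurable hB), inter_comm, ← image_inter_preimage]
  have := hs.hausdorffMeasure_image_le (d := 1) zero_le_one (A ∩ s ⁻¹' B)
  rw [hausdorffMeasure_real] at this
  simpa [inter_comm] using this

/-- The upper gradient inequality along `1`-Lipschitz, not necessarily arc length parametrized,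
curves. -/
theorem IsUpperGradient.abs_le_add_lintegral {g : P → ℝ≥0∞} {u : P → EReal}
    (h : IsUpperGradient g u) {γ : ℝ → P} (hγ : LipschitzWith 1 γ) {l : ℝ} (hl : 0 ≤ l) :
    (u (γ 0)).abs ≤ (u (γ l)).abs + ∫⁻ t in Icc 0 l, g (γ t) := by
  -- Distinct end points ensure that the arc length parametrization has positive length, as the
  -- definition of upper gradient demands.
  by_cases heq : γ 0 = γ l
  · rw [heq]; exact le_self_add
  have h0 : (0 : ℝ) ∈ Icc 0 l := ⟨le_rfl, hl⟩
  have hl' : l ∈ Icc 0 l := ⟨hl, le_rfl⟩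
  have hloc : LocallyBoundedVariationOn γ (Icc 0 l) :=
    (hγ.lipschitzOnWith (s := Icc 0 l)).locallyBoundedVariationOn
  obtain ⟨s, hs, hsv, -⟩ :=
    (hγ.lipschitzOnWith_variationOnFromTo h0).exists_lipschitzWith_eqOn_Icc hl
  have hs0 : s 0 = 0 := by rw [hsv h0, variationOnFromTo.self]
  have hmono : MonotoneOn s (Icc 0 l) :=
    (variationOnFromTo.monotoneOn hloc h0).congr hsv.symm
  have himg : s '' Icc 0 l = Icc 0 (s l) := by
    refine Subset.antisymm ?_ ?_
    · rintro _ ⟨t, ht, rfl⟩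
      exact ⟨hs0 ▸ hmono h0 ht ht.1, hmono ht hl' ht.2⟩
    · have := intermediate_value_Icc hl hs.continuous.continuousOn
      rwa [hs0] at this
  set η := naturalParameterization γ (Icc 0 l) 0 with hη
  have hηs : ∀ t ∈ Icc 0 l, η (s t) = γ t := fun t ht => by
    rw [hsv ht]
    exact edist_eq_zero.1 (edist_naturalParameterization_eq_zero hloc h0 ht)
  have hunit : HasUnitSpeedOn η (Icc 0 (s l)) := by
    rw [← himg, image_congr hsv]
    exact has_unit_speed_naturalParameterization γ hloc h0
  have hη0 : η 0 = γ 0 := by simpa [hs0] using hηs 0 h0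
  have hηl : η (s l) = γ l := hηs l hl'
  have hpos : 0 < s l := by
    refine lt_of_le_of_ne (hs0 ▸ hmono h0 hl' hl) fun h => heq ?_
    rw [← hη0, ← hηl, ← h]
  have hsl : 0 ≤ s l := hpos.le
  have hint : ∫⁻ t in Icc 0 (s l), g (η t) ≤ ∫⁻ t in Icc 0 l, g (γ t) := by
    -- The natural parametrization is well behaved only on `[0, s l]`; its Lipschitz extension makes
    -- the integrand measurable on all of `ℝ`.
    obtain ⟨η', hη', hηη', -⟩ := hunit.lipschitzOnWith.exists_lipschitzWith_eqOn_Icc hsl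
    have hmeas : Measurable fun t => g (η' t) := by
      borelize P
      exact h.1.comp hη'.continuous.measurable
    calc ∫⁻ t in Icc 0 (s l), g (η t) = ∫⁻ t in Icc 0 (s l), g (η' t) :=
          setLIntegral_congr_fun measurableSet_Icc fun t ht => by simp only [hηη' ht]
      _ = ∫⁻ t in s '' Icc 0 l, g (η' t) := by rw [himg]
      _ ≤ ∫⁻ t in Icc 0 l, g (η' (s t)) :=
          setLIntegral_image_le_of_lipschitzWith hs _ hmeas
      _ = ∫⁻ t in Icc 0 l, g (γ t) :=
          setLIntegral_congr_fun measurableSet_Icc fun t ht => by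
            have : s t ∈ Icc 0 (s l) := himg ▸ mem_image_of_mem s ht
            simp only [hηη' this, hηs t ht]
  have hug := h.2 (s l) η hpos hunit
  rw [hη0, hηl] at hug
  have htri : ∀ a b : EReal, a.abs ≤ b.abs + (a - b).abs := by
    intro a b
    induction b with
    | bot => simp
    | top => simp
    | coe b =>
      induction a with
      | bot => simp
      | top => simp
      | coe a =>
        rw [← EReal.coe_sub, EReal.abs_def, EReal.abs_def, EReal.abs_def,
          ← ENNReal.ofReal_add (abs_nonneg _) (abs_nonneg _)]
        refine ENNReal.ofReal_le_ofReal ?_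
        have := abs_add_le b (a - b)
        simpa using this
  exact (htri _ _).trans (add_le_add_right (hug.trans hint) _)

end Curves

/-! ### The infimum over curves and functions controlled along curves. -/

section Descent

variable {P : Type*} [MetricSpace P]

/-- `U` changes by at most the integral of `H` along every `1`-Lipschitz curve. -/
def CurveControlled (H U : P → ℝ≥0∞) : Prop :=
  ∀ (γ : ℝ → P) (l : ℝ), LipschitzWith 1 γ → 0 ≤ l →
    U (γ 0) ≤ U (γ l) + ∫⁻ t in Icc 0 l, H (γ t)

/-- The infimum of the integrals of `h` along curves starting at `x`, plus the value of `v` at the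
end point. -/
noncomputable def curveInf (v h : P → ℝ≥0∞) (x : P) : ℝ≥0∞ :=
  ⨅ (γ : ℝ → P) (l : ℝ) (_ : LipschitzWith 1 γ) (_ : γ 0 = x) (_ : 0 ≤ l),
    v (γ l) + ∫⁻ t in Icc 0 l, h (γ t)

theorem curveInf_le {v h : P → ℝ≥0∞} {γ : ℝ → P} {l : ℝ} (hγ : LipschitzWith 1 γ) (hl : 0 ≤ l) :
    curveInf v h (γ 0) ≤ v (γ l) + ∫⁻ t in Icc 0 l, h (γ t) :=
  iInf_le_of_le γ <| iInf_le_of_le l <| iInf_le_of_le hγ <| iInf_le_of_le rfl <| iInf_le _ hl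

theorem le_curveInf {v h : P → ℝ≥0∞} {x : P} {a : ℝ≥0∞}
    (H : ∀ (γ : ℝ → P) (l : ℝ), LipschitzWith 1 γ → γ 0 = x → 0 ≤ l →
      a ≤ v (γ l) + ∫⁻ t in Icc 0 l, h (γ t)) : a ≤ curveInf v h x :=
  le_iInf fun γ => le_iInf fun l => le_iInf fun hγ => le_iInf fun hx => le_iInf fun hl =>
    H γ l hγ hx hl

theorem exists_of_curveInf_lt {v h : P → ℝ≥0∞} {x : P} {a : ℝ≥0∞} (H : curveInf v h x < a) :
    ∃ (γ : ℝ → P) (l : ℝ), LipschitzWith 1 γ ∧ γ 0 = x ∧ 0 ≤ l ∧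
      v (γ l) + ∫⁻ t in Icc 0 l, h (γ t) < a := by
  simp only [curveInf, iInf_lt_iff] at H
  obtain ⟨γ, l, h₁, h₂, h₃, h₄⟩ := H
  exact ⟨γ, l, h₁, h₂, h₃, h₄⟩

theorem curveInf_le_self (v h : P → ℝ≥0∞) (x : P) : curveInf v h x ≤ v x := by
  have := curveInf_le (v := v) (h := h) (γ := fun _ => x) (l := 0) (LipschitzWith.const' x) le_rfl
  simpa using this

/-- A nearly optimal curve from the end point of `γ₁`, appended to `γ₁`, competes in the infimum at
the starting point. -/
theorem curveControlled_curveInf (v h : P → ℝ≥0∞) : CurveControlled h (curveInf v h) := by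
  intro γ₁ l₁ h₁ hl₁
  refine ENNReal.le_of_forall_pos_le_add fun ε hε hfin => ?_
  have hU : curveInf v h (γ₁ l₁) < ∞ := lt_of_le_of_lt le_self_add hfin
  obtain ⟨γ₂, l₂, h₂, h0, hl₂, hlt⟩ := exists_of_curveInf_lt
    (ENNReal.lt_add_right hU.ne (ENNReal.coe_pos.2 hε).ne')
  have key := curveInf_le (v := v) (h := h) (h₁.concat h₂ h0) (add_nonneg hl₁ hl₂)
  simp only [hl₁, if_true] at key
  have hend : (if l₁ + l₂ ≤ l₁ then γ₁ (l₁ + l₂) else γ₂ (l₁ + l₂ - l₁)) = γ₂ l₂ := by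
    split_ifs with hle
    · have : l₂ = 0 := by linarith
      rw [this, add_zero, h0]
    · rw [add_sub_cancel_left]
  rw [hend] at key
  have hsplit : Icc 0 (l₁ + l₂) ⊆ Icc 0 l₁ ∪ Ioc l₁ (l₁ + l₂) := by
    rw [Icc_union_Ioc_eq_Icc hl₁ (by linarith)]
  have hI : ∫⁻ t in Icc 0 (l₁ + l₂), h (if t ≤ l₁ then γ₁ t else γ₂ (t - l₁)) ≤
      (∫⁻ t in Icc 0 l₁, h (γ₁ t)) + ∫⁻ t in Icc 0 l₂, h (γ₂ t) := by
    refine (lintegral_mono_set hsplit).trans ((lintegral_union_le _ _ _).trans (add_le_add ?_ ?_))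
    · exact (setLIntegral_congr_fun measurableSet_Icc fun t ht => by simp [ht.2]).le
    · calc ∫⁻ t in Ioc l₁ (l₁ + l₂), h (if t ≤ l₁ then γ₁ t else γ₂ (t - l₁))
          = ∫⁻ t in Ioc l₁ (l₁ + l₂), h (γ₂ (t - l₁)) :=
            setLIntegral_congr_fun measurableSet_Ioc fun t ht => by simp [not_le.2 ht.1]
        _ ≤ ∫⁻ t in (fun t => t - l₁) ⁻¹' Icc 0 l₂, h (γ₂ (t - l₁)) :=
            lintegral_mono_set fun t ht => ⟨by linarith [ht.1], by linarith [ht.2]⟩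
        _ = ∫⁻ t in Icc 0 l₂, h (γ₂ t) :=
            (measurePreserving_sub_right volume l₁).setLIntegral_comp_preimage_emb
              (MeasurableEquiv.subRight l₁).measurableEmbedding (fun t => h (γ₂ t)) _
  calc curveInf v h (γ₁ 0) ≤ _ := key
    _ ≤ v (γ₂ l₂) + ((∫⁻ t in Icc 0 l₁, h (γ₁ t)) + ∫⁻ t in Icc 0 l₂, h (γ₂ t)) :=
        add_le_add_right hI _
    _ = (v (γ₂ l₂) + ∫⁻ t in Icc 0 l₂, h (γ₂ t)) + ∫⁻ t in Icc 0 l₁, h (γ₁ t) := by ring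
    _ ≤ (curveInf v h (γ₁ l₁) + ε) + ∫⁻ t in Icc 0 l₁, h (γ₁ t) := add_le_add_left hlt.le _
    _ = _ := by ring

theorem CurveControlled.reverse {H U : P → ℝ≥0∞} (hU : CurveControlled H U) {γ : ℝ → P} {l : ℝ}
    (hγ : LipschitzWith 1 γ) (hl : 0 ≤ l) :
    U (γ l) ≤ U (γ 0) + ∫⁻ t in Icc 0 l, H (γ t) := by
  have := hU _ l (hγ.reverse l) hl
  simp only [sub_zero, sub_self] at this
  refine this.trans_eq ?_
  congr 1
  have e := (Measure.measurePreserving_sub_left volume l).setLIntegral_comp_preimage_emb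
    (MeasurableEquiv.subLeft l).measurableEmbedding (fun t => H (γ t)) (Icc 0 l)
  rw [← e]
  congr 2
  ext t
  simp only [mem_preimage, mem_Icc]
  constructor <;> rintro ⟨a, b⟩ <;> constructor <;> linarith

theorem CurveControlled.mono {H H' U : P → ℝ≥0∞} (hU : CurveControlled H U) (hH : ∀ x, H x ≤ H' x) :
    CurveControlled H' U := fun γ l hγ hl =>
  (hU γ l hγ hl).trans (add_le_add_right (lintegral_mono fun t => hH (γ t)) _)

theorem CurveControlled.const_mul {H U : P → ℝ≥0∞} (hU : CurveControlled H U) {c : ℝ≥0∞}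
    (hc : c ≠ ∞) : CurveControlled (fun x => c * H x) (fun x => c * U x) := fun γ l hγ hl => by
  simp only [lintegral_const_mul' c _ hc, ← mul_add]
  exact mul_le_mul_right (hU γ l hγ hl) c

theorem CurveControlled.tsum {H U : ℕ → P → ℝ≥0∞} (hU : ∀ n, CurveControlled (H n) (U n))
    (hH : ∀ n, LowerSemicontinuous (H n)) :
    CurveControlled (fun x => ∑' n, H n x) (fun x => ∑' n, U n x) := fun γ l hγ hl => by
  have hm : ∀ n, Measurable fun t => H n (γ t) := fun n =>
    ((hH n).comp hγ.continuous).measurable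
  rw [lintegral_tsum fun n => (hm n).aemeasurable, ← ENNReal.tsum_add]
  exact ENNReal.tsum_le_tsum fun n => hU n γ l hγ hl

/-- A controlled function, truncated at level one, has the control as an upper gradient. -/
theorem CurveControlled.isUpperGradient {H U : P → ℝ≥0∞} (hU : CurveControlled H U)
    (hH : LowerSemicontinuous H) :
    IsUpperGradient H fun x => ((min (U x) 1 : ℝ≥0∞) : EReal) := by
  refine ⟨by borelize P; exact hH.measurable, fun l γ hl hγ => ?_⟩
  obtain ⟨γ', hγ', heq, -⟩ := hγ.lipschitzOnWith.exists_lipschitzWith_eqOn_Icc hl.le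
  have h1 := hU γ' l hγ' hl.le
  have h2 := hU.reverse hγ' hl.le
  rw [setLIntegral_congr_fun measurableSet_Icc (g := fun t => H (γ t))
    (fun t ht => by simp only [heq ht]), heq ⟨le_rfl, hl.le⟩, heq ⟨hl.le, le_rfl⟩] at h1 h2
  change (((min (U (γ 0)) 1 : ℝ≥0∞) : EReal) - ((min (U (γ l)) 1 : ℝ≥0∞) : EReal)).abs ≤ _
  generalize ∫⁻ t in Icc 0 l, H (γ t) = I at h1 h2 ⊢
  have key : ∀ a b : ℝ≥0∞, a ≤ b + I → min a 1 ≤ min b 1 + I := by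
    intro a b hab
    rcases le_total b 1 with hb | hb
    · rw [min_eq_left hb]; exact (min_le_left _ _).trans hab
    · rw [min_eq_right hb]; exact (min_le_right _ _).trans le_self_add
  replace h1 := key _ _ h1
  replace h2 := key _ _ h2
  -- Truncation makes both values finite, so the convention for `∞ - ∞` does not intervene.
  have hfin : ∀ a : ℝ≥0∞, min a 1 ≠ ∞ := fun a => ((min_le_right _ _).trans_lt ENNReal.one_lt_top).ne
  have hfa := hfin (U (γ 0))
  have hfb := hfin (U (γ l))
  generalize min (U (γ 0)) 1 = a at *
  generalize min (U (γ l)) 1 = b at *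
  lift a to ℝ≥0 using hfa
  lift b to ℝ≥0 using hfb
  by_cases hI : I = ∞
  · rw [hI]; exact le_top
  lift I to ℝ≥0 using hI
  norm_cast at h1 h2
  change (((a : ℝ) : EReal) - ((b : ℝ) : EReal)).abs ≤ (I : ℝ≥0∞)
  rw [← EReal.coe_sub, EReal.abs_def]
  refine ENNReal.ofReal_le_of_le_toReal ?_
  rw [ENNReal.coe_toReal, abs_le]
  have h1' : (a : ℝ) ≤ b + I := by exact_mod_cast h1
  have h2' : (b : ℝ) ≤ a + I := by exact_mod_cast h2
  constructor <;> linarith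

end Descent

/-! ### Compactness of curves and lower semicontinuity of the infimum. -/

section LowerSemicontinuity

variable {P : Type*} [MetricSpace P]

/-- Arzelà–Ascoli for sequences of `1`-Lipschitz curves, in terms of pointwise convergence. -/
theorem exists_subseq_tendsto_of_lipschitzWith {K : ℝ → Set P} (hK : ∀ t, IsCompact (K t))
    {γ : ℕ → ℝ → P} (hγ : ∀ n, LipschitzWith 1 (γ n)) (hγK : ∀ n t, γ n t ∈ K t) :
    ∃ (φ : ℕ → ℕ) (η : ℝ → P), StrictMono φ ∧ LipschitzWith 1 η ∧
      ∀ t, Tendsto (fun n => γ (φ n) t) atTop (𝓝 (η t)) := by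
  -- Tychonoff over the rationals replaces the diagonal argument; equicontinuity then gives
  -- convergence at every real parameter.
  have hcomp : IsCompact (univ.pi fun q : ℚ => K (q : ℝ)) := isCompact_univ_pi fun q => hK q
  obtain ⟨a, -, φ, hφ, ha⟩ := hcomp.isSeqCompact (x := fun n (q : ℚ) => γ n (q : ℝ))
    fun n q _ => hγK n q
  rw [tendsto_pi_nhds] at ha
  have hlim : ∀ t, ∃ y, Tendsto (fun n => γ (φ n) t) atTop (𝓝 y) := by
    intro t
    have hc : CauchySeq fun n => γ (φ n) t := by
      rw [Metric.cauchySeq_iff]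
      intro ε hε
      obtain ⟨q, hq₁, hq₂⟩ := exists_rat_btwn (show t < t + ε / 4 by linarith)
      obtain ⟨N, hN⟩ := Metric.cauchySeq_iff.1 (ha q).cauchySeq (ε / 4) (by linarith)
      refine ⟨N, fun m hm n hn => ?_⟩
      have h1 : ∀ k, dist (γ k t) (γ k q) ≤ ε / 4 := fun k => by
        refine ((hγ k).dist_le_mul _ _).trans ?_
        rw [NNReal.coe_one, one_mul, Real.dist_eq, abs_le]
        constructor <;> linarith
      have h2 := hN m hm n hn
      simp only [Function.comp_apply] at h2
      have h3 := dist_triangle4 (γ (φ m) t) (γ (φ m) q) (γ (φ n) q) (γ (φ n) t)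
      have h4 := h1 (φ m)
      have h5 := h1 (φ n)
      rw [dist_comm] at h5
      linarith
    obtain ⟨y, -, hy⟩ := cauchySeq_tendsto_of_isComplete (hK t).isComplete (fun n => hγK (φ n) t) hc
    exact ⟨y, hy⟩
  choose η hη using hlim
  refine ⟨φ, η, hφ, LipschitzWith.of_dist_le_mul fun s t => ?_, hη⟩
  exact le_of_tendsto ((hη s).dist (hη t)) (Eventually.of_forall fun n => (hγ _).dist_le_mul s t)

/-- A curve starting in an open set `Ω` can be stopped when it leaves `Ω`. If the end point function
vanishes off `Ω`, this does not increase the cost. -/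
theorem exists_mem_closure_of_curve {Ω : Set P} (hΩ : IsOpen Ω) {v : P → ℝ≥0∞}
    (hv : ∀ x ∉ Ω, v x = 0) (h : P → ℝ≥0∞) {γ : ℝ → P} {l : ℝ} (hγ : LipschitzWith 1 γ)
    (hl : 0 ≤ l) (h0 : γ 0 ∈ Ω) :
    ∃ (γ' : ℝ → P) (l' : ℝ), LipschitzWith 1 γ' ∧ 0 ≤ l' ∧ γ' 0 = γ 0 ∧ (∀ t, γ' t ∈ closure Ω) ∧
      v (γ' l') + ∫⁻ t in Icc 0 l', h (γ' t) ≤ v (γ l) + ∫⁻ t in Icc 0 l, h (γ t) := by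
  have main : ∀ τ, 0 ≤ τ → τ ≤ l → (∀ t ∈ Ico 0 τ, γ t ∈ Ω) → v (γ τ) ≤ v (γ l) →
      ∃ (γ' : ℝ → P) (l' : ℝ), LipschitzWith 1 γ' ∧ 0 ≤ l' ∧ γ' 0 = γ 0 ∧
        (∀ t, γ' t ∈ closure Ω) ∧
        v (γ' l') + ∫⁻ t in Icc 0 l', h (γ' t) ≤ v (γ l) + ∫⁻ t in Icc 0 l, h (γ t) := by
    intro τ hτ hτl hmem hvτ
    obtain ⟨γ', hγ', heq, him⟩ :=
      (hγ.lipschitzOnWith (s := Icc 0 τ)).exists_lipschitzWith_eqOn_Icc hτ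
    refine ⟨γ', τ, hγ', hτ, heq ⟨le_rfl, hτ⟩, fun t => ?_, ?_⟩
    · have hsub : γ '' Icc 0 τ ⊆ closure Ω := by
        rintro _ ⟨s, hs, rfl⟩
        rcases hτ.eq_or_lt with h | h
        · have : s = 0 := le_antisymm (hs.2.trans h.symm.le) hs.1
          exact subset_closure (this ▸ h0)
        · have : s ∈ closure (Ico 0 τ) := by rwa [closure_Ico h.ne]
          exact closure_mono (image_subset_iff.2 hmem)
            (image_closure_subset_closure_image hγ.continuous (mem_image_of_mem γ this))
      exact hsub (him t)
    · rw [heq ⟨hτ, le_rfl⟩, setLIntegral_congr_fun measurableSet_Icc (g := fun t => h (γ t))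
        (fun t ht => by simp only [heq ht])]
      exact add_le_add hvτ (lintegral_mono_set (Icc_subset_Icc_right hτl))
  by_cases hstay : ∀ t ∈ Icc 0 l, γ t ∈ Ω
  · exact main l hl le_rfl (fun t ht => hstay t ⟨ht.1, ht.2.le⟩) le_rfl
  -- Otherwise stop at the first exit time, where `v` vanishes.
  · have hcpt : IsCompact (Icc 0 l ∩ γ ⁻¹' Ωᶜ) :=
      isCompact_Icc.inter_right (hΩ.isClosed_compl.preimage hγ.continuous)
    push Not at hstay
    obtain ⟨t₀, ht₀, ht₀'⟩ := hstay
    obtain ⟨τ, hτ, hleast⟩ := hcpt.exists_isLeast ⟨t₀, ht₀, ht₀'⟩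
    refine main τ hτ.1.1 hτ.1.2 (fun t ht => ?_) (by rw [hv _ hτ.2]; exact zero_le)
    by_contra hcon
    exact absurd (hleast ⟨⟨ht.1, ht.2.le.trans hτ.1.2⟩, hcon⟩) (not_le.2 ht.2)

/-- The limit step in the lower semicontinuity of `curveInf`. -/
theorem curveInf_le_of_tendsto {v h : P → ℝ≥0∞} (hv : LowerSemicontinuous v)
    (hh : LowerSemicontinuous h) {δ : ℝ≥0∞} (hδ : δ ≠ 0) (hδv : ∀ x, δ * v x ≤ h x)
    {γ : ℕ → ℝ → P} {η : ℝ → P} {l : ℕ → ℝ} {ℓ : ℝ≥0∞} {y : ℝ≥0∞} (hy : y ≠ ∞)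
    (hγ : ∀ n, LipschitzWith 1 (γ n)) (hη : LipschitzWith 1 η)
    (hlim : ∀ t, Tendsto (fun n => γ n t) atTop (𝓝 (η t))) (hl : ∀ n, 0 ≤ l n)
    (hlℓ : Tendsto (fun n => ENNReal.ofReal (l n)) atTop (𝓝 ℓ))
    (hcost : ∀ n, v (γ n (l n)) + ∫⁻ t in Icc 0 (l n), h (γ n t) ≤ y) :
    curveInf v h (η 0) ≤ y := by
  have hmeas : ∀ {ζ : ℝ → P}, LipschitzWith 1 ζ → Measurable fun t => h (ζ t) := fun hζ =>
    (hh.comp hζ.continuous).measurable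
  -- Each `t` with `t < ℓ` eventually lies in `[0, l n]`, so Fatou's lemma applies with lower
  -- semicontinuity of `h`.
  have hfatou : ∀ A : Set ℝ, MeasurableSet A → (∀ t ∈ A, 0 ≤ t ∧ ENNReal.ofReal t < ℓ) →
      ∫⁻ t in A, h (η t) ≤ liminf (fun n => ∫⁻ t in Icc 0 (l n), h (γ n t)) atTop := by
    intro A hA hAℓ
    have hpt : ∀ t, A.indicator (fun t => h (η t)) t ≤
        liminf (fun n => (Icc 0 (l n)).indicator (fun t => h (γ n t)) t) atTop := by
      intro t
      by_cases ht : t ∈ A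
      · rw [indicator_of_mem ht]
        have hev : ∀ᶠ n in atTop, t ∈ Icc 0 (l n) := by
          filter_upwards [hlℓ.eventually (lt_mem_nhds (hAℓ t ht).2)] with n hn
          exact ⟨(hAℓ t ht).1, ((ENNReal.ofReal_lt_ofReal_iff').1 hn).1.le⟩
        rw [liminf_congr (v := fun n => h (γ n t))
          (hev.mono fun n hn => indicator_of_mem hn _)]
        refine (hh.le_liminf (η t)).trans ?_
        rw [show (fun n => h (γ n t)) = h ∘ fun n => γ n t from rfl, liminf_comp]
        exact liminf_le_liminf_of_le (hlim t)
      · rw [indicator_of_notMem ht]; exact zero_le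
    calc ∫⁻ t in A, h (η t) = ∫⁻ t, A.indicator (fun t => h (η t)) t := (lintegral_indicator hA _).symm
      _ ≤ ∫⁻ t, liminf (fun n => (Icc 0 (l n)).indicator (fun t => h (γ n t)) t) atTop :=
          lintegral_mono hpt
      _ ≤ liminf (fun n => ∫⁻ t, (Icc 0 (l n)).indicator (fun t => h (γ n t)) t) atTop :=
          lintegral_liminf_le fun n => (hmeas (hγ n)).indicator measurableSet_Icc
      _ = _ := by simp only [lintegral_indicator measurableSet_Icc]
  -- For infinite limiting length, `δ * v ≤ h` and the finite integral of `h` over the half-line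
  -- give a time `T` with `v (η T) ≤ ε`; stopping there costs at most `y + ε`.
  rcases eq_or_ne ℓ ∞ with rfl | hℓ
  · have hI : ∫⁻ t in Ici 0, h (η t) ≤ y := by
      refine (hfatou (Ici 0) measurableSet_Ici fun t ht => ⟨ht, ENNReal.ofReal_lt_top⟩).trans ?_
      exact liminf_le_of_le (by isBoundedDefault) fun b hb => by
        obtain ⟨n, hn⟩ := hb.exists
        exact hn.trans (le_add_self.trans (hcost n))
    refine ENNReal.le_of_forall_pos_le_add fun ε hε _ => ?_
    have hex : ∃ T, 0 ≤ T ∧ v (η T) ≤ ε := by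
      by_contra! hcon
      have : ∫⁻ t in Ici (0 : ℝ), δ * ε ≤ ∫⁻ t in Ici 0, h (η t) :=
        setLIntegral_mono' measurableSet_Ici fun t ht =>
          (mul_le_mul_right (hcon t ht).le δ).trans (hδv _)
      rw [setLIntegral_const, Real.volume_Ici, ENNReal.mul_top] at this
      · exact hy (top_le_iff.1 (this.trans hI))
      · exact mul_ne_zero hδ (ENNReal.coe_pos.2 hε).ne'
    obtain ⟨T, hT, hvT⟩ := hex
    refine (curveInf_le hη hT).trans ?_
    rw [add_comm]
    exact add_le_add ((lintegral_mono_set Icc_subset_Ici_self).trans hI) hvT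
  · have hL : 0 ≤ ℓ.toReal := ENNReal.toReal_nonneg
    have hlL : Tendsto l atTop (𝓝 ℓ.toReal) := by
      have := (ENNReal.tendsto_toReal hℓ).comp hlℓ
      refine this.congr fun n => ?_
      simp [ENNReal.toReal_ofReal (hl n)]
    have hI : ∫⁻ t in Icc 0 ℓ.toReal, h (η t) ≤
        liminf (fun n => ∫⁻ t in Icc 0 (l n), h (γ n t)) atTop := by
      -- The time `ℓ` itself need not belong to the intervals `[0, l n]`, but it is a null set.
      rw [setLIntegral_congr (Ico_ae_eq_Icc (μ := volume)).symm]
      refine hfatou _ measurableSet_Ico fun t ht => ⟨ht.1, ?_⟩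
      rw [ENNReal.ofReal_lt_iff_lt_toReal ht.1 hℓ]
      exact ht.2
    have hend : Tendsto (fun n => γ n (l n)) atTop (𝓝 (η ℓ.toReal)) := by
      rw [tendsto_iff_dist_tendsto_zero]
      have h1 := tendsto_iff_dist_tendsto_zero.1 (hlim ℓ.toReal)
      have h2 := tendsto_iff_dist_tendsto_zero.1 hlL
      refine squeeze_zero (fun _ => dist_nonneg) (fun n => ?_) (by simpa using h2.add h1)
      refine (dist_triangle _ (γ n ℓ.toReal) _).trans (add_le_add_left ?_ _)
      simpa using (hγ n).dist_le_mul (l n) ℓ.toReal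
    have hV : v (η ℓ.toReal) ≤ liminf (fun n => v (γ n (l n))) atTop := by
      refine (hv.le_liminf _).trans ?_
      rw [show (fun n => v (γ n (l n))) = v ∘ fun n => γ n (l n) from rfl, liminf_comp]
      exact liminf_le_liminf_of_le hend
    refine (curveInf_le hη hL).trans ((add_le_add hV hI).trans ?_)
    rw [liminf_eq_iSup_iInf_of_nat, liminf_eq_iSup_iInf_of_nat,
      ENNReal.iSup_add_iSup_of_monotone (fun _ _ h => biInf_mono fun _ => h.trans)
        (fun _ _ h => biInf_mono fun _ => h.trans)]
    exact iSup_le fun n => (add_le_add (iInf₂_le n le_rfl) (iInf₂_le n le_rfl)).trans (hcost n)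

/-- If the part of the space near `Ω` is proper, `v` vanishes off `Ω`, and `v` is dominated by a
multiple of `h`, then `curveInf v h` is lower semicontinuous. -/
theorem lowerSemicontinuous_curveInf {Ω : Set P} (hΩ : IsOpen Ω)
    (hK : ∀ x r, IsCompact (closure Ω ∩ closedBall x r)) {v h : P → ℝ≥0∞}
    (hv : LowerSemicontinuous v) (hh : LowerSemicontinuous h) (hv0 : ∀ x ∉ Ω, v x = 0)
    {δ : ℝ≥0∞} (hδ : δ ≠ 0) (hδv : ∀ x, δ * v x ≤ h x) :
    LowerSemicontinuous (curveInf v h) := by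
  rw [lowerSemicontinuous_iff_isClosed_preimage]
  intro y
  refine IsSeqClosed.isClosed fun x p hx hxp => ?_
  by_cases hp : p ∈ Ω
  swap
  · exact (curveInf_le_self v h p).trans (by rw [hv0 p hp]; exact zero_le)
  change curveInf v h p ≤ y
  -- The infimum need not be attained, so curves of cost at most some `y' > y` are used; `y' < y''`
  -- also makes `y'` finite.
  refine le_of_forall_gt fun y'' hy'' => ?_
  obtain ⟨y', hy, hy'⟩ := exists_between hy''
  refine lt_of_le_of_lt ?_ hy'
  obtain ⟨N, hN⟩ := eventually_atTop.1
    ((hxp.eventually (hΩ.mem_nhds hp)).and (hxp.eventually (ball_mem_nhds p one_pos)))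
  have hcurve : ∀ n, ∃ (γ : ℝ → P) (l : ℝ), LipschitzWith 1 γ ∧ 0 ≤ l ∧ γ 0 = x (n + N) ∧
      (∀ t, γ t ∈ closure Ω) ∧ v (γ l) + ∫⁻ t in Icc 0 l, h (γ t) ≤ y' := by
    intro n
    obtain ⟨γ, l, hγ, h0, hl, hlt⟩ := exists_of_curveInf_lt ((hx (n + N)).trans_lt hy)
    obtain ⟨γ', l', h1, h2, h3, h4, h5⟩ := exists_mem_closure_of_curve hΩ hv0 h hγ hl
      (h0 ▸ (hN (n + N) (Nat.le_add_left _ _)).1)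
    exact ⟨γ', l', h1, h2, h3.trans h0, h4, h5.trans hlt.le⟩
  choose γ l hγ hl h0 hmem hcost using hcurve
  -- Lengths are unbounded a priori; compactness of `[0, ∞]` still gives a limit, possibly infinite.
  obtain ⟨ℓ, φ, hφ, hℓ⟩ := CompactSpace.tendsto_subseq fun n => ENNReal.ofReal (l n)
  obtain ⟨ψ, η, hψ, hη, hlim⟩ := exists_subseq_tendsto_of_lipschitzWith
    (K := fun t => closure Ω ∩ closedBall p (|t| + 1)) (fun t => hK p _)
    (γ := fun n => γ (φ n)) (fun n => hγ _) fun n t => ⟨hmem _ t, by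
      have h1 := (hγ (φ n)).dist_le_mul t 0
      have h2 := (hN (φ n + N) (Nat.le_add_left _ _)).2
      rw [← h0] at h2
      rw [NNReal.coe_one, one_mul, Real.dist_eq, sub_zero] at h1
      exact (dist_triangle _ (γ (φ n) 0) _).trans (add_le_add h1 h2.le)⟩
  have hη0 : η 0 = p := by
    refine tendsto_nhds_unique (hlim 0) ?_
    simp only [h0]
    exact hxp.comp ((tendsto_add_atTop_nat N).comp (hφ.comp hψ).tendsto_atTop)
  rw [← hη0]
  exact curveInf_le_of_tendsto hv hh hδ hδv (hy'.trans_le le_top).ne (fun n => hγ _) hη hlim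
    (fun n => hl _) (hℓ.comp hψ.tendsto_atTop) (fun n => hcost _)

end LowerSemicontinuity

/-! ### Replacing a function by a lower semicontinuous one. -/

section Construction

variable {P : Type*} [MetricSpace P]

theorem LowerSemicontinuous.indicator_ennreal {f : P → ℝ≥0∞} (hf : LowerSemicontinuous f)
    {Ω : Set P} (hΩ : IsOpen Ω) : LowerSemicontinuous (Ω.indicator f) := by
  intro x y hy
  by_cases hx : x ∈ Ω
  · rw [indicator_of_mem hx] at hy
    filter_upwards [hΩ.mem_nhds hx, hf x y hy] with z hz hz'
    rwa [indicator_of_mem hz]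
  · rw [indicator_of_notMem hx] at hy
    exact absurd hy not_lt_zero

theorem LowerSemicontinuous.const_mul_ennreal {f : P → ℝ≥0∞} (hf : LowerSemicontinuous f)
    {c : ℝ≥0∞} (hc : c ≠ ∞) : LowerSemicontinuous fun x => c * f x :=
  (ENNReal.continuous_const_mul hc).comp_lowerSemicontinuous hf fun _ _ h => mul_le_mul_right h c

/-- The lower bound for `curveInf`: either a curve is so short that it stays in `Ω`, or the term
`v / r` compensates for the missing end point. -/
theorem one_le_curveInf {g v : P → ℝ≥0∞} {u : P → EReal} (hg : LowerSemicontinuous g)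
    (hug : IsUpperGradient g u) (huv : ∀ x, (u x).abs ≤ v x) {Ω : Set P} {r : ℝ≥0} (hr : 0 < r) {y : P} (hy : 1 ≤ (u y).abs) (hball : ball y r ⊆ Ω) :
    1 ≤ curveInf (Ω.indicator v) (Ω.indicator fun x => g x + (r : ℝ≥0∞)⁻¹ * v x) y := by
  refine le_curveInf fun γ l hγ h0 hl => ?_
  have hin : ∀ t : ℝ, 0 ≤ t → t < r → γ t ∈ Ω := fun t ht htr => hball <| by
    have := hγ.dist_le_mul t 0
    rw [h0, NNReal.coe_one, one_mul, Real.dist_eq, sub_zero, abs_of_nonneg ht] at this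
    exact this.trans_lt htr
  have hmain : ∀ t, 0 ≤ t → 1 ≤ v (γ t) + ∫⁻ s in Icc 0 t, g (γ s) := fun t ht => by
    have := hug.abs_le_add_lintegral hγ ht
    rw [h0] at this
    exact hy.trans (this.trans (add_le_add_left (huv _) _))
  rcases lt_or_ge l r with hlr | hlr
  · rw [indicator_of_mem (hin l hl hlr)]
    refine (hmain l hl).trans (add_le_add_right (setLIntegral_mono' measurableSet_Icc ?_) _)
    intro t ht
    rw [indicator_of_mem (hin t ht.1 (ht.2.trans_lt hlr))]
    exact le_self_add
  -- Up to time `r` the curve stays in `Ω` and satisfies `v ≥ 1 - J` there, so the integral of `v /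
  -- r` supplies the missing `1 - J`.
  · set J := ∫⁻ s in Ico 0 (r : ℝ), g (γ s) with hJ
    have hvJ : ∀ t ∈ Ico 0 (r : ℝ), 1 - J ≤ v (γ t) := fun t ht => by
      rw [tsub_le_iff_right]
      refine (hmain t ht.1).trans (add_le_add_right (lintegral_mono_set ?_) _)
      exact fun s hs => ⟨hs.1, hs.2.trans_lt ht.2⟩
    have hr0 : (r : ℝ≥0∞) ≠ 0 := (ENNReal.coe_pos.2 hr).ne'
    calc (1 : ℝ≥0∞) ≤ J + (1 - J) := le_add_tsub
      _ = J + ∫⁻ _ in Ico 0 (r : ℝ), (r : ℝ≥0∞)⁻¹ * (1 - J) := by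
          rw [setLIntegral_const, Real.volume_Ico, sub_zero, ENNReal.ofReal_coe_nnreal, mul_right_comm,
            ENNReal.inv_mul_cancel hr0 ENNReal.coe_ne_top, one_mul]
      _ ≤ J + ∫⁻ t in Ico 0 (r : ℝ), (r : ℝ≥0∞)⁻¹ * v (γ t) :=
          add_le_add_right (setLIntegral_mono' measurableSet_Ico fun t ht =>
            mul_le_mul_right (hvJ t ht) _) _
      _ = ∫⁻ t in Ico 0 (r : ℝ), (g (γ t) + (r : ℝ≥0∞)⁻¹ * v (γ t)) :=
          (lintegral_add_left (hg.comp hγ.continuous).measurable _).symm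
      _ = ∫⁻ t in Ico 0 (r : ℝ), Ω.indicator (fun x => g x + (r : ℝ≥0∞)⁻¹ * v x) (γ t) :=
          setLIntegral_congr_fun measurableSet_Ico fun t ht => by
            simp only [indicator_of_mem (hin t ht.1 ht.2)]
      _ ≤ ∫⁻ t in Icc 0 l, Ω.indicator (fun x => g x + (r : ℝ≥0∞)⁻¹ * v x) (γ t) :=
          lintegral_mono_set fun t ht => ⟨ht.1, ht.2.le.trans hlr⟩
      _ ≤ _ := le_add_self

/-- A function with a lower semicontinuous upper gradient `g` and a lower semicontinuous majorant
`v` can be replaced by a lower semicontinuous function, at the cost of increasing the gradient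
by `v / r`. -/
theorem exists_lowerSemicontinuous_curveControlled {g v : P → ℝ≥0∞} {u : P → EReal}
    (hg : LowerSemicontinuous g) (hv : LowerSemicontinuous v) (hug : IsUpperGradient g u)
    (huv : ∀ x, (u x).abs ≤ v x) {Ω : Set P} (hΩ : IsOpen Ω)
    (hK : ∀ x r, IsCompact (closure Ω ∩ closedBall x r)) {r : ℝ≥0} (hr : 0 < r) :
    ∃ U : P → ℝ≥0∞, LowerSemicontinuous U ∧ (∀ x, U x ≤ v x) ∧
      CurveControlled (fun x => g x + (r : ℝ≥0∞)⁻¹ * v x) U ∧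
      ∀ y, 1 ≤ (u y).abs → ball y r ⊆ Ω → 1 ≤ U y := by
  have hr' : (r : ℝ≥0∞)⁻¹ ≠ ∞ := ENNReal.inv_ne_top.2 (ENNReal.coe_pos.2 hr).ne'
  refine ⟨curveInf (Ω.indicator v) (Ω.indicator fun x => g x + (r : ℝ≥0∞)⁻¹ * v x), ?_,
    fun x => ?_, ?_, fun y hy hball => one_le_curveInf hg hug huv hr hy hball⟩
  · refine lowerSemicontinuous_curveInf hΩ hK (hv.indicator_ennreal hΩ)
      ((hg.add (hv.const_mul_ennreal hr')).indicator_ennreal hΩ)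
      (fun x hx => indicator_of_notMem hx _)
      (ENNReal.inv_ne_zero.2 (ENNReal.coe_ne_top (r := r))) fun x => ?_
    by_cases hx : x ∈ Ω
    · simp only [indicator_of_mem hx]; exact le_add_self
    · simp [indicator_of_notMem hx]
  · exact (curveInf_le_self _ _ x).trans (indicator_le_self _ _ x)
  · exact (curveControlled_curveInf _ _).mono fun x => indicator_le_self _ _ x

end Construction

/-! ### Quasinorms of nonnegative functions. -/

theorem EReal.abs_coe_ennreal (a : ℝ≥0∞) : (a : EReal).abs = a := by
  induction a with
  | top => rfl
  | coe a =>
    change ((a : ℝ) : EReal).abs = _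
    rw [EReal.abs_def, abs_of_nonneg a.coe_nonneg, ENNReal.ofReal_coe_nnreal]

theorem EReal.one_le_abs {x : EReal} (hx : 1 ≤ x) : 1 ≤ x.abs := by
  induction x with
  | bot => simp
  | top => simp
  | coe x =>
    rw [EReal.abs_def, ENNReal.one_le_ofReal]
    exact (by exact_mod_cast hx : (1 : ℝ) ≤ x).trans (le_abs_self x)

theorem LowerSemicontinuous.measurable_borel {P : Type*} [TopologicalSpace P] {g : P → ℝ≥0∞}
    (hg : LowerSemicontinuous g) : @Measurable P ℝ≥0∞ (borel P) inferInstance g := by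
  borelize P
  exact hg.measurable

namespace QuasiBanachFunctionLattice

section Quasinorm

variable {P : Type*} [MeasurableSpace P] {μ : Measure P} (X : QuasiBanachFunctionLattice μ)

theorem qnorm_coe_mono {f f' : P → ℝ≥0∞} (hf : Measurable f) (hf' : Measurable f')
    (h : ∀ x, f x ≤ f' x) : X.qnorm (fun x => (f x : EReal)) ≤ X.qnorm fun x => (f' x : EReal) :=
  X.lattice _ _ hf.coe_ereal_ennreal hf'.coe_ereal_ennreal <| ae_of_all _ fun x => by
    rw [EReal.abs_coe_ennreal, EReal.abs_coe_ennreal]; exact h x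

theorem qnorm_coe_const_mul {f : P → ℝ≥0∞} (hf : Measurable f) (c : ℝ≥0) :
    X.qnorm (fun x => ((c * f x : ℝ≥0∞) : EReal)) = c * X.qnorm fun x => (f x : EReal) := by
  have := X.smul c _ hf.coe_ereal_ennreal
  rw [abs_of_nonneg c.coe_nonneg, ENNReal.ofReal_coe_nnreal] at this
  rw [← this]
  congr 1
  ext x
  rw [EReal.coe_ennreal_mul]
  rfl

theorem qnorm_coe_add_le {f f' : P → ℝ≥0∞} (hf : Measurable f) (hf' : Measurable f') :
    X.qnorm (fun x => ((f x + f' x : ℝ≥0∞) : EReal)) ≤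
      X.concavity * (X.qnorm (fun x => (f x : EReal)) + X.qnorm fun x => (f' x : EReal)) := by
  simpa only [EReal.coe_ennreal_add] using
    X.add_le _ _ hf.coe_ereal_ennreal hf'.coe_ereal_ennreal

/-- The function equal to `∞` where `f = ∞` and to `0` elsewhere is unchanged by doubling. Its
finite quasinorm therefore equals its own double, hence is zero. -/
theorem ae_lt_top_of_qnorm_lt_top {f : P → ℝ≥0∞} (hf : Measurable f)
    (h : X.qnorm (fun x => (f x : EReal)) < ∞) : ∀ᵐ x ∂μ, f x < ∞ := by
  set k : P → ℝ≥0∞ := (f ⁻¹' {∞}).indicator fun _ => ∞ with hk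
  have hkm : Measurable k := measurable_const.indicator (hf (measurableSet_singleton _))
  have hkf : X.qnorm (fun x => (k x : EReal)) ≤ X.qnorm fun x => (f x : EReal) :=
    X.qnorm_coe_mono hkm hf fun x => by
      refine indicator_le' (fun x hx => ?_) (fun x _ => zero_le) x
      rw [show f x = ∞ from hx]
  have h2 := X.qnorm_coe_const_mul hkm 2
  have h2k : (fun x => (((2 : ℝ≥0) : ℝ≥0∞) * k x)) = k := by
    ext x
    by_cases hx : x ∈ f ⁻¹' {∞}
    · simp [hk, indicator_of_mem hx, ENNReal.mul_top]
    · simp [hk, indicator_of_notMem hx]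
  have h2k' : (fun x => ((((2 : ℝ≥0) : ℝ≥0∞) * k x : ℝ≥0∞) : EReal)) = fun x => (k x : EReal) :=
    funext fun x => congrArg _ (congrFun h2k x)
  rw [h2k'] at h2
  have hzero : X.qnorm (fun x => (k x : EReal)) = 0 := by
    have hfin := (hkf.trans_lt h).ne
    lift X.qnorm (fun x => (k x : EReal)) to ℝ≥0 using hfin with q
    norm_cast at h2 ⊢
    have h2' : (q : ℝ) = 2 * q := by exact_mod_cast h2
    exact NNReal.coe_eq_zero.1 (by linarith)
  filter_upwards [(X.eq_zero_iff _ hkm.coe_ereal_ennreal).1 hzero] with x hx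
  by_contra hcon
  have hx' : x ∈ f ⁻¹' {∞} := not_lt_top_iff.1 hcon
  simp [hk, indicator_of_mem hx'] at hx

/-- Continuity of the quasinorm along `g + v / (n + 1) → g`. -/
theorem ContinuousQuasinorm.tendsto_qnorm_add_inv_mul {X : QuasiBanachFunctionLattice μ}
    (hX : X.ContinuousQuasinorm) {g v : P → ℝ≥0∞} (hg : Measurable g) (hv : Measurable v)
    (hgX : X.qnorm (fun x => (g x : EReal)) < ∞) (hvX : X.qnorm (fun x => (v x : EReal)) < ∞) :
    Tendsto (fun n : ℕ => X.qnorm fun x => ((g x + (((n : ℝ≥0) + 1 : ℝ≥0) : ℝ≥0∞)⁻¹ * v x : ℝ≥0∞) :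
      EReal)) atTop (𝓝 (X.qnorm fun x => (g x : EReal))) := by
  have hinv : ∀ n : ℕ, (((n : ℝ≥0) + 1 : ℝ≥0) : ℝ≥0∞)⁻¹ = (((n : ℝ≥0) + 1)⁻¹ : ℝ≥0) := fun n =>
    (ENNReal.coe_inv (by positivity)).symm
  simp only [hinv]
  have hm : ∀ n : ℕ, Measurable fun x => ((((n : ℝ≥0) + 1)⁻¹ : ℝ≥0) : ℝ≥0∞) * v x := fun n =>
    hv.const_mul _
  refine hX _ _ (fun n => (hg.add (hm n)).coe_ereal_ennreal) hg.coe_ereal_ennreal ?_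
  have hlim : Tendsto (fun n : ℕ => ((((n : ℝ≥0) + 1)⁻¹ : ℝ≥0) : ℝ≥0∞) *
      X.qnorm fun x => (v x : EReal)) atTop (𝓝 0) := by
    have h0 : Tendsto (fun n : ℕ => ((((n : ℝ≥0) + 1)⁻¹ : ℝ≥0) : ℝ≥0∞)) atTop (𝓝 0) := by
      have := (tendsto_inv_atTop_nhds_zero_nat (𝕜 := ℝ≥0)).comp (tendsto_add_atTop_nat 1)
      rw [← ENNReal.coe_zero, ENNReal.tendsto_coe]
      simpa [Function.comp_def] using this
    simpa using ENNReal.Tendsto.mul_const h0 (Or.inr hvX.ne)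
  refine tendsto_of_tendsto_of_tendsto_of_le_of_le tendsto_const_nhds hlim (fun _ => zero_le)
    fun n => ?_
  dsimp only
  rw [← X.qnorm_coe_const_mul hv]
  refine X.lattice _ _ ((hg.add (hm n)).coe_ereal_ennreal.sub hg.coe_ereal_ennreal)
    (hm n).coe_ereal_ennreal ?_
  -- Where `g` is finite it cancels from the difference, leaving exactly the added multiple of `v`.
  filter_upwards [X.ae_lt_top_of_qnorm_lt_top hg hgX] with x hx
  lift g x to ℝ≥0 using hx.ne with a
  generalize ((((n : ℝ≥0) + 1)⁻¹ : ℝ≥0) : ℝ≥0∞) * v x = b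
  rw [add_comm, EReal.coe_ennreal_add]
  exact (congrArg EReal.abs (EReal.add_sub_cancel_right (a := (b : EReal)) (b := (a : ℝ)))).le

end Quasinorm

/-! ### Capacity estimates and the outer capacity, part (a). -/

section Capacity

variable {P : Type*} [MetricSpace P] [MeasurableSpace P] {μ : Measure P}
  {X : QuasiBanachFunctionLattice μ}

theorem capacity_le_newtonianNorm {E : Set P} {u : P → EReal} (hu : u ∈ X.newtonianSpace)
    (hE : ∀ x ∈ E, 1 ≤ u x) : X.capacity E ≤ X.newtonianNorm u :=
  iInf_le_of_le u (iInf_le_of_le hu (iInf_le _ hE))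

/-- The truncation `min F 1` is admissible: it has smaller quasinorm than `F` and keeps `H` as an
upper gradient. -/
theorem capacity_le_of_curveControlled [OpensMeasurableSpace P] {E : Set P} {F H : P → ℝ≥0∞} (hF : Measurable F)
    (hH : LowerSemicontinuous H) (hFH : CurveControlled H F) (hE : ∀ x ∈ E, 1 ≤ F x) :
    X.capacity E ≤ X.qnorm (fun x => (F x : EReal)) + X.qnorm fun x => (H x : EReal) := by
  rcases eq_or_ne (X.qnorm (fun x => (F x : EReal)) + X.qnorm fun x => (H x : EReal)) ∞ with h | h
  · rw [h]; exact le_top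
  have hm : Measurable fun x => min (F x) 1 := hF.min measurable_const
  have hle := X.qnorm_coe_mono hm hF fun x => min_le_left _ _
  have hN : X.newtonianNorm (fun x => ((min (F x) 1 : ℝ≥0∞) : EReal)) ≤
      X.qnorm (fun x => (F x : EReal)) + X.qnorm fun x => (H x : EReal) :=
    add_le_add hle (iInf₂_le H (hFH.isUpperGradient hH))
  refine (capacity_le_newtonianNorm ⟨⟨hm.coe_ereal_ennreal, ?_⟩, ?_⟩ fun x hx => ?_).trans hN
  · exact hle.trans_lt (le_self_add.trans_lt h.lt_top)
  · exact hN.trans_lt h.lt_top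
  · rw [min_eq_right (hE x hx)]; rfl

theorem VitaliCaratheodory.exists_lowerSemicontinuous_lt (hVC : X.VitaliCaratheodory) {w : P → EReal}
    (hw : Measurable w) {b : ℝ≥0∞} (hb : X.qnorm w < b) :
    ∃ f : P → ℝ≥0∞, LowerSemicontinuous f ∧ (∀ x, (w x).abs ≤ f x) ∧
      X.qnorm (fun x => (f x : EReal)) < b := by
  rw [hVC w hw] at hb
  simp only [iInf_lt_iff] at hb
  obtain ⟨v, hwv, hv, hvb⟩ := hb
  have hcoe : ∀ x, ((v x).toENNReal : EReal) = v x := fun x =>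
    EReal.coe_toENNReal ((EReal.coe_ennreal_nonneg _).trans (hwv x))
  refine ⟨fun x => (v x).toENNReal, ?_, fun x => ?_, by simpa only [hcoe] using hvb⟩
  · exact EReal.continuous_toENNReal.comp_lowerSemicontinuous hv
      fun _ _ h => EReal.toENNReal_le_toENNReal h
  · have := hwv x
    rw [← hcoe x] at this
    exact EReal.coe_ennreal_le_coe_ennreal_iff.1 this

variable [OpensMeasurableSpace P]

/-- Any Borel function above an upper gradient is again one, so the gradient can be made lower
semicontinuous. The function `u` cannot be enlarged in this way and only receives a majorant `v`. -/
theorem VitaliCaratheodory.exists_of_capacity_lt (hVC : X.VitaliCaratheodory) {E : Set P}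
    {a : ℝ≥0∞} (ha : X.capacity E < a) :
    ∃ (u : P → EReal) (g v : P → ℝ≥0∞), LowerSemicontinuous g ∧ LowerSemicontinuous v ∧
      IsUpperGradient g u ∧ (∀ x, (u x).abs ≤ v x) ∧ (∀ x ∈ E, 1 ≤ (u x).abs) ∧
      X.qnorm (fun x => (v x : EReal)) + X.qnorm (fun x => (g x : EReal)) < a := by
  simp only [capacity, iInf_lt_iff] at ha
  obtain ⟨u, hu, hE, ha⟩ := ha
  rw [newtonianNorm, ← lt_tsub_iff_left] at ha
  simp only [iInf_lt_iff] at ha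
  obtain ⟨g₀, hg₀, ha⟩ := ha
  have hg₀m : Measurable g₀ := hg₀.1.mono OpensMeasurableSpace.borel_le le_rfl
  obtain ⟨g, hg, hgg, ha⟩ := hVC.exists_lowerSemicontinuous_lt hg₀m.coe_ereal_ennreal ha
  rw [lt_tsub_iff_left, ← lt_tsub_iff_right] at ha
  obtain ⟨v, hv, huv, ha⟩ := hVC.exists_lowerSemicontinuous_lt hu.1.1 ha
  rw [lt_tsub_iff_right] at ha
  simp only [EReal.abs_coe_ennreal] at hgg
  refine ⟨u, g, v, hg, hv, ⟨hg.measurable_borel, fun l γ hl hγ => ?_⟩, huv,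
    fun x hx => EReal.one_le_abs (hE x hx), ha⟩
  exact (hg₀.2 l γ hl hγ).trans (lintegral_mono fun t => hgg _)

theorem isOuterCapacity_of_properSpace [ProperSpace P] (hX : X.ContinuousQuasinorm)
    (hVC : X.VitaliCaratheodory) : X.IsOuterCapacity := by
  intro E
  rw [ENNReal.coe_one, one_mul]
  refine le_of_forall_gt fun a ha => ?_
  obtain ⟨u, g, v, hg, hv, hug, huv, huE, hlt⟩ := hVC.exists_of_capacity_lt ha
  have hvX : X.qnorm (fun x => (v x : EReal)) < ∞ :=
    le_self_add.trans_lt (hlt.trans_le le_top)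
  have hgX : X.qnorm (fun x => (g x : EReal)) < ∞ :=
    le_add_self.trans_lt (hlt.trans_le le_top)
  have hlim := hX.tendsto_qnorm_add_inv_mul hg.measurable hv.measurable hgX hvX
  -- A factor slightly above one turns `U ≥ 1` on `E` into a strict inequality, which defines an
  -- open set. It tends to one along with `v / (n + 1)` tending to zero, so the total cost converges
  -- to `‖v‖ + ‖g‖ < a`.
  have hθ : Tendsto (fun n : ℕ => ((1 + ((n : ℝ≥0) + 1)⁻¹ : ℝ≥0) : ℝ≥0∞)) atTop (𝓝 1) := by
    have := (tendsto_inv_atTop_nhds_zero_nat (𝕜 := ℝ≥0)).comp (tendsto_add_atTop_nat 1)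
    rw [← ENNReal.coe_one, ENNReal.tendsto_coe]
    simpa [Function.comp_def] using this.const_add 1
  have hprod := ENNReal.Tendsto.mul hθ (Or.inl one_ne_zero) (hlim.const_add
    (X.qnorm fun x => (v x : EReal))) (Or.inr ENNReal.one_ne_top)
  rw [one_mul] at hprod
  obtain ⟨n, hn⟩ := (hprod.eventually (gt_mem_nhds hlt)).exists
  set θ : ℝ≥0 := 1 + ((n : ℝ≥0) + 1)⁻¹ with hθdef
  have hθ1 : (1 : ℝ≥0∞) < θ := by
    rw [hθdef, ← ENNReal.coe_one, ENNReal.coe_lt_coe]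
    exact lt_add_of_pos_right _ (by positivity)
  obtain ⟨U, hU, hUv, hUH, hU1⟩ := exists_lowerSemicontinuous_curveControlled hg hv hug huv
    isOpen_univ (fun x r => by rw [closure_univ, univ_inter]; exact isCompact_closedBall x r)
    (r := (n : ℝ≥0) + 1) (by positivity)
  have hr' : (((n : ℝ≥0) + 1 : ℝ≥0) : ℝ≥0∞)⁻¹ ≠ ∞ := ENNReal.inv_ne_top.2 (by positivity)
  have hH := hg.add (hv.const_mul_ennreal hr')
  have hθU := hU.const_mul_ennreal (ENNReal.coe_ne_top (r := θ))
  have hopen : IsOpen {x | 1 < θ * U x} := hθU.isOpen_preimage 1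
  have hsub : E ⊆ {x | 1 < θ * U x} := fun x hx =>
    hθ1.trans_le (le_mul_of_one_le_right' (hU1 x (huE x hx) (subset_univ _)))
  have hinf : (⨅ (G : Set P) (_ : IsOpen G) (_ : E ⊆ G), X.capacity G) ≤
      X.capacity {x | 1 < θ * U x} :=
    iInf_le_of_le _ (iInf_le_of_le hopen (iInf_le _ hsub))
  refine (hinf.trans ?_).trans_lt hn
  refine (capacity_le_of_curveControlled hθU.measurable
    (hH.const_mul_ennreal (ENNReal.coe_ne_top (r := θ)))
    (hUH.const_mul (ENNReal.coe_ne_top (r := θ))) fun x hx => le_of_lt hx).trans ?_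
  rw [X.qnorm_coe_const_mul hU.measurable, X.qnorm_coe_const_mul hH.measurable, ← mul_add]
  exact mul_le_mul_right (add_le_add_left
    (X.qnorm_coe_mono hU.measurable hv.measurable hUv) _) _

end Capacity

end QuasiBanachFunctionLattice

/-! ### Countable covers and quasicontinuity, part (b). -/

/-- A metric space with a measure that is positive and finite on balls is second countable. -/
theorem PositiveFiniteOnBalls.secondCountableTopology {P : Type*} [MetricSpace P]
    [MeasurableSpace P] [OpensMeasurableSpace P] {μ : Measure P} (hμ : PositiveFiniteOnBalls μ) :
    SecondCountableTopology P := by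
  rcases isEmpty_or_nonempty P with hP | ⟨⟨x₀⟩⟩
  · infer_instance
  have hσ : SigmaFinite μ := by
    refine ⟨⟨⟨fun n => ball x₀ (n + 1), fun _ => trivial, fun n => (hμ x₀ _ (by positivity)).2, ?_⟩⟩⟩
    refine eq_univ_of_forall fun x => mem_iUnion.2 ?_
    obtain ⟨n, hn⟩ := exists_nat_gt (dist x x₀)
    exact ⟨n, hn.trans (lt_add_one _)⟩
  refine Metric.secondCountable_of_almost_dense_set fun ε hε => ?_
  -- Disjoint balls of radius `ε / 5` have positive measure, hence are countably many by
  -- σ-finiteness; their fivefold enlargements cover the space.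
  obtain ⟨s, -, hdisj, hcov⟩ := Vitali.exists_disjoint_subfamily_covering_enlargement_closedBall
    (univ : Set P) id (fun _ => ε / 5) (ε / 5) (fun _ _ => le_rfl) 5 (by norm_num)
  have hε5 : 0 < ε / 5 := by positivity
  refine ⟨s, ?_, fun x => ?_⟩
  · have hcount : Set.Countable {i : s | 0 < μ (closedBall (i : P) (ε / 5))} :=
      Measure.countable_meas_pos_of_disjoint_iUnion (fun i => isClosed_closedBall.measurableSet)
        fun i j hij => hdisj i.2 j.2 (Subtype.coe_injective.ne hij)
    have huniv : {i : s | 0 < μ (closedBall (i : P) (ε / 5))} = univ :=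
      eq_univ_of_forall fun i => (hμ i _ hε5).1.trans_le (measure_mono ball_subset_closedBall)
    rw [huniv, countable_univ_iff] at hcount
    exact hcount.to_set
  · obtain ⟨y, hy, hsub⟩ := hcov x (mem_univ x)
    have := hsub (mem_closedBall_self hε5.le)
    exact ⟨y, hy, by simpa [mul_div_cancel₀] using this⟩

namespace QuasiBanachFunctionLattice

variable {P : Type*} [MetricSpace P] [MeasurableSpace P] [OpensMeasurableSpace P] {μ : Measure P}
  {X : QuasiBanachFunctionLattice μ}

/-- Near a compact ball, sets of small capacity have neighbourhoods that are small in a sense that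
is suitable for countable summation. -/
theorem VitaliCaratheodory.exists_curveControlled_of_capacity_lt (hVC : X.VitaliCaratheodory)
    {x : P} {r : ℝ≥0} (hr : 0 < r) (hcpt : IsCompact (closedBall x (2 * r))) {E : Set P} {ε : ℝ≥0}
    (hE : X.capacity E < ε) :
    ∃ F H : P → ℝ≥0∞, LowerSemicontinuous F ∧ LowerSemicontinuous H ∧ CurveControlled H F ∧
      (∀ y ∈ E ∩ ball x r, 1 < F y) ∧
      X.qnorm (fun x => (F x : EReal)) + X.qnorm (fun x => (H x : EReal)) ≤
        (2 + 2 * (X.concavity * (1 + r⁻¹))) * ε := by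
  obtain ⟨u, g, v, hg, hv, hug, huv, huE, hlt⟩ := hVC.exists_of_capacity_lt hE
  obtain ⟨U, hU, hUv, hUH, hU1⟩ := exists_lowerSemicontinuous_curveControlled hg hv hug huv
    (isOpen_ball (x := x) (ε := 2 * r)) (fun y s => by
      refine (hcpt.of_isClosed_subset isClosed_closure ?_).inter_right isClosed_closedBall
      exact closure_ball_subset_closedBall) hr
  have hrinv : (r : ℝ≥0∞)⁻¹ = (r⁻¹ : ℝ≥0) := (ENNReal.coe_inv hr.ne').symm
  rw [hrinv] at hUH
  have hrv : LowerSemicontinuous fun x => ((r⁻¹ : ℝ≥0) : ℝ≥0∞) * v x :=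
    hv.const_mul_ennreal ENNReal.coe_ne_top
  have hH := hg.add hrv
  -- The factor 2 makes `U ≥ 1` strict; the quasi-triangle inequality for `g + v / r` contributes
  -- `X.concavity * (1 + r⁻¹)`.
  refine ⟨fun x => (2 : ℝ≥0) * U x,
    fun x => (2 : ℝ≥0) * (g x + ((r⁻¹ : ℝ≥0) : ℝ≥0∞) * v x),
    hU.const_mul_ennreal ENNReal.coe_ne_top, hH.const_mul_ennreal ENNReal.coe_ne_top,
    hUH.const_mul ENNReal.coe_ne_top, fun y hy => ?_, ?_⟩
  · refine lt_of_lt_of_le (b := ((2 : ℝ≥0) : ℝ≥0∞)) (by norm_num)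
      (le_mul_of_one_le_right' (hU1 y (huE y hy.1) (ball_subset_ball' ?_)))
    have := hy.2
    rw [mem_ball] at this
    linarith
  · rw [X.qnorm_coe_const_mul hU.measurable, X.qnorm_coe_const_mul hH.measurable]
    have hvε : X.qnorm (fun x => (v x : EReal)) ≤ ε := le_self_add.trans hlt.le
    have hgε : X.qnorm (fun x => (g x : EReal)) ≤ ε := le_add_self.trans hlt.le
    have hUε := (X.qnorm_coe_mono hU.measurable hv.measurable hUv).trans hvε
    have hHε : X.qnorm (fun x => ((g x + ((r⁻¹ : ℝ≥0) : ℝ≥0∞) * v x : ℝ≥0∞) : EReal)) ≤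
        X.concavity * (ε + (r⁻¹ : ℝ≥0) * ε) := by
      refine (X.qnorm_coe_add_le hg.measurable hrv.measurable).trans ?_
      rw [X.qnorm_coe_const_mul hv.measurable]
      gcongr
    calc _ ≤ ((2 : ℝ≥0) : ℝ≥0∞) * ε +
          ((2 : ℝ≥0) : ℝ≥0∞) * (X.concavity * (ε + (r⁻¹ : ℝ≥0) * ε)) := by gcongr
      _ = _ := by push_cast; ring

/-- The sum of all `F n` exceeds one on the union and is controlled by the sum of all `H n`; the
Riesz–Fischer property bounds both sums. -/
theorem capacity_iUnion_le {F H : ℕ → P → ℝ≥0∞} (hF : ∀ n, LowerSemicontinuous (F n))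
    (hH : ∀ n, LowerSemicontinuous (H n)) (hFH : ∀ n, CurveControlled (H n) (F n)) :
    X.capacity (⋃ n, {x | 1 < F n x}) ≤ ∑' n, (X.concavity : ℝ≥0∞) ^ (n + 1) *
      (X.qnorm (fun x => (F n x : EReal)) + X.qnorm fun x => (H n x : EReal)) := by
  refine (capacity_le_of_curveControlled (lowerSemicontinuous_tsum hF).measurable
    (lowerSemicontinuous_tsum hH) (CurveControlled.tsum hFH hH) fun x hx => ?_).trans ?_
  · obtain ⟨n, hn⟩ := mem_iUnion.1 hx
    exact (le_of_lt hn).trans (ENNReal.le_tsum n)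
  · simp only [mul_add]
    rw [ENNReal.tsum_add]
    exact add_le_add (X.riesz_fischer F fun n => (hF n).measurable)
      (X.riesz_fischer H fun n => (hH n).measurable)

theorem WeaklyQuasicontinuous.quasicontinuous [LocallyCompactSpace P]
    (hμ : PositiveFiniteOnBalls μ) (hVC : X.VitaliCaratheodory) {u : P → EReal}
    (hu : X.WeaklyQuasicontinuous u) : X.Quasicontinuous u := by
  intro ε hε
  rcases isEmpty_or_nonempty P with hP | hP
  · obtain ⟨E, hE⟩ := hu ε hε
    exact ⟨E, by rw [E.eq_empty_of_isEmpty]; exact isOpen_empty, hE⟩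
  have := hμ.secondCountableTopology
  have hball : ∀ x : P, ∃ r : ℝ≥0, 0 < r ∧ IsCompact (closedBall x (2 * r)) := fun x => by
    obtain ⟨R, hR, hc⟩ := Metric.exists_isCompact_closedBall x
    lift R to ℝ≥0 using hR.le
    refine ⟨R / 2, half_pos (NNReal.coe_pos.1 hR), ?_⟩
    rwa [NNReal.coe_div, NNReal.coe_ofNat, mul_div_cancel₀ _ two_ne_zero]
  choose r hr hcpt using hball
  obtain ⟨s, hs, hcov⟩ := TopologicalSpace.countable_cover_nhds
    fun x => ball_mem_nhds x (NNReal.coe_pos.2 (hr x))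
  have hsne : s.Nonempty := by
    by_contra hcon
    rw [not_nonempty_iff_eq_empty.1 hcon] at hcov
    simp only [mem_empty_iff_false, iUnion_of_empty, iUnion_empty] at hcov
    exact empty_ne_univ hcov
  obtain ⟨x, rfl⟩ := hs.exists_eq_range hsne
  rw [biUnion_range] at hcov
  obtain ⟨ε', hε', hsum⟩ := ENNReal.exists_pos_sum_of_countable (ENNReal.coe_pos.2 hε).ne' ℕ
  have hc : 0 < X.concavity := one_pos.trans_le X.one_le_concavity
  -- `M n` collects the Riesz–Fischer weight and the loss in the `n`-th ball, so exceptional sets of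
  -- capacity below `ε' n / M n` contribute at most `ε' n`.
  set M : ℕ → ℝ≥0 := fun n =>
    X.concavity ^ (n + 1) * (2 + 2 * (X.concavity * (1 + (r (x n))⁻¹))) with hM
  have hMpos : ∀ n, 0 < M n := fun n => by positivity
  choose E hE hcont using fun n => hu (ε' n / M n) (div_pos (hε' n) (hMpos n))
  choose F H hF hH hFH hF1 hle using fun n =>
    hVC.exists_curveControlled_of_capacity_lt (hr (x n)) (hcpt (x n)) (hE n)
  have key : ∀ y ∉ ⋃ n, {z | 1 < F n z}, ∃ n, y ∈ ball (x n) (r (x n)) := fun y _ => by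
    simpa using (hcov ▸ mem_univ y : y ∈ ⋃ n, ball (x n) (r (x n)))
  -- Continuity is local: off the open union, the `n`-th ball avoids the exceptional set `E n`,
  -- although `E n` may be large elsewhere.
  have hsub : ∀ n, ball (x n) (r (x n)) ∩ (⋃ n, {z | 1 < F n z})ᶜ ⊆ (E n)ᶜ := fun n y hy hyE =>
    hy.2 (mem_iUnion.2 ⟨n, hF1 n y ⟨hyE, hy.1⟩⟩)
  refine ⟨⋃ n, {z | 1 < F n z}, isOpen_iUnion fun n => (hF n).isOpen_preimage 1, ?_, ?_, ?_⟩
  · refine (capacity_iUnion_le hF hH hFH).trans_lt (lt_of_le_of_lt ?_ hsum)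
    refine ENNReal.tsum_le_tsum fun n => (mul_le_mul_right (hle n) _).trans_eq ?_
    rw [← mul_assoc]
    have : ε' n = M n * (ε' n / M n) := (mul_div_cancel₀ _ (hMpos n).ne').symm
    conv_rhs => rw [this]
    rw [hM]
    push_cast
    rfl
  · intro y hy
    obtain ⟨n, hn⟩ := key y hy
    refine ((hcont n).1 y (hsub n ⟨hn, hy⟩)).mono_of_mem_nhdsWithin ?_
    exact mem_of_superset (inter_mem_nhdsWithin _ (isOpen_ball.mem_nhds hn))
      fun z hz => hsub n ⟨hz.2, hz.1⟩
  · intro y hy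
    obtain ⟨n, hn⟩ := key y hy
    exact (hcont n).2 y (hsub n ⟨hn, hy⟩)

end QuasiBanachFunctionLattice

theorem theorem1p5 {P : Type*} [MetricSpace P] [MeasurableSpace P] [OpensMeasurableSpace P]
    (μ : MeasureTheory.Measure P) [μ.IsComplete] (hμ : PositiveFiniteOnBalls μ)
    (X : QuasiBanachFunctionLattice μ) (hX : X.ContinuousQuasinorm)
    (hVC : X.VitaliCaratheodory) :
    (ProperSpace P → X.IsOuterCapacity) ∧
    (LocallyCompactSpace P →
      ∀ u : P → EReal, X.WeaklyQuasicontinuous u → X.Quasicontinuous u) :=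
  ⟨fun _ => QuasiBanachFunctionLattice.isOuterCapacity_of_properSpace hX hVC,
    fun _ _ hu => hu.quasicontinuous hμ hVC⟩
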